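/- **Theorem 2.2 (Controllability Gramian Condition).** Let $\mathbb{T}$ be a time scale (a nonempty closed subset of $\mathbb{R}$) that is unbounded above, with forward jump operator $\sigma(t)=\inf\{s\in\mathbb{T}: s>t\}$ and graininess $\mu(t)=\sigma(t)-t$. Let $A(t)\in\mathbb{R}^{n\times n}$ and $B(t)\in\mathbb{R}^{n\times m}$ be rd-continuous on $\mathbb{T}$ (each entry is continuous at the right-dense points and has finite left-sided limits at the left-dense points), and let $A$ be regressive, i.e. $I+\mu(t)A(t)$ is invertible for all $t\in\mathbb{T}$. Let $t_0\le t_f$ be points of $\mathbb{T}$. For $s\in\mathbb{T}$ let $\Phi_A(\cdot,s)$ be the (existing and unique) solution on $\mathbb{T}$ of $X^\Delta(t)=A(t)X(t)$, $X(s)=I$, where $\Delta$ denotes the delta derivative. Then the entries of $\Phi_A(t_0,\sigma(t))B(t)B^T(t)\Phi_A^T(t_0,\sigma(t))$ have delta antiderivatives on $\mathbb{T}$, and the linear system $$x^\Delta(t)=A(t)x(t)+B(t)u(t),\qquad x(t_0)=x_0,$$ is controllable on $[t_0,t_f]$ if and only if the $n\times n$ controllability Gramian matrix $$\mathscr{G}_C(t_0,t_f)=\int_{t_0}^{t_f}\Phi_A(t_0,\sigma(t))B(t)B^T(t)\Phi_A^T(t_0,\sigma(t))\,\Delta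 t$$ is invertible. Here the delta integral is taken entrywise, $\int_a^b f(t)\,\Delta t=F(b)-F(a)$ with $F^\Delta=f$ on $\mathbb{T}$. Controllable on $[t_0,t_f]$ means that for all $x_0,x_f\in\mathbb{R}^n$ there is an rd-continuous input $u:\mathbb{T}\to\mathbb{R}^m$ such that the corresponding solution of the system satisfies $x(t_f)=x_f$. The same equivalence holds for each single prescribed final state $x_f\in\mathbb{R}^n$, i.e. when controllability only asks that every initial state $x_0$ can be steered to this $x_f$. -/

import Mathlib

open Filter Topology

/-- A time scale: a nonempty closed subset of the real line. -/
structure TimeScale where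
  carrier : Set ℝ
  nonempty : carrier.Nonempty
  isClosed : IsClosed carrier

namespace TimeScale

instance : CoeSort TimeScale Type := ⟨fun T => T.carrier⟩

variable {T : TimeScale}

theorem sInf_mem (t : T) (h : ∃ s : T, t < s) :
    sInf {s : ℝ | s ∈ T.carrier ∧ (t : ℝ) < s} ∈ T.carrier := by
  obtain ⟨s, hs⟩ := h
  refine closure_minimal (fun x hx => hx.1) T.isClosed
    (csInf_mem_closure (s := {s : ℝ | s ∈ T.carrier ∧ (t : ℝ) < s}) ⟨s, s.2, hs⟩
      ⟨t, fun x hx => hx.2.le⟩)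

theorem sSup_mem (t : T) (h : ∃ s : T, s < t) :
    sSup {s : ℝ | s ∈ T.carrier ∧ s < (t : ℝ)} ∈ T.carrier := by
  obtain ⟨s, hs⟩ := h
  refine closure_minimal (fun x hx => hx.1) T.isClosed
    (csSup_mem_closure (s := {s : ℝ | s ∈ T.carrier ∧ s < (t : ℝ)}) ⟨s, s.2, hs⟩
      ⟨t, fun x hx => hx.2.le⟩)

open Classical in
/-- Forward jump `σ(t) = inf {s ∈ T | s > t}`, with `σ(t) = t` if `t` is the maximum of `T`. -/
noncomputable def sigma (t : T) : T :=
  if h : ∃ s : T, t < s then ⟨sInf {s : ℝ | s ∈ T.carrier ∧ (t : ℝ) < s}, sInf_mem t h⟩ else t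

open Classical in
/-- Backward jump `ρ(t) = sup {s ∈ T | s < t}`, with `ρ(t) = t` if `t` is the minimum of `T`. -/
noncomputable def rho (t : T) : T :=
  if h : ∃ s : T, s < t then ⟨sSup {s : ℝ | s ∈ T.carrier ∧ s < (t : ℝ)}, sSup_mem t h⟩ else t

/-- Graininess `μ(t) = σ(t) - t`. -/
noncomputable def mu (t : T) : ℝ := (sigma t : ℝ) - t

/-- `t < sup T` and `σ(t) = t`. -/
def RightDense (t : T) : Prop := (∃ s : T, t < s) ∧ sigma t = t

/-- `t > inf T` and `ρ(t) = t`. -/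
def LeftDense (t : T) : Prop := (∃ s : T, s < t) ∧ rho t = t

section Calculus

variable {E : Type*} [NormedAddCommGroup E] [NormedSpace ℝ E]

/-- rd-continuity: continuity at the right-dense points, finite left-sided limits at the
left-dense points. -/
def RdContinuous (f : T → E) : Prop :=
  (∀ t : T, RightDense t → ContinuousAt f t) ∧
    ∀ t : T, LeftDense t → ∃ l : E, Tendsto f (𝓝[<] t) (𝓝 l)

/-- `f` has delta derivative `f'` at `t` (neighbourhoods are taken in `T`). This is the usual
notion at every point that is not a left-scattered maximum of `T`. -/
def HasDeltaDerivAt (f : T → E) (f' : E) (t : T) : Prop :=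
  ∀ ε : ℝ, 0 < ε → ∀ᶠ s : T in 𝓝 t,
    ‖f (sigma t) - f s - ((sigma t : ℝ) - s) • f'‖ ≤ ε * |(sigma t : ℝ) - s|

/-- `F` is a delta antiderivative of `f` (on a time scale without maximum). -/
def IsAntiderivative (F f : T → E) : Prop := ∀ t : T, HasDeltaDerivAt F (f t) t

open Classical in
/-- The (Cauchy) delta integral `∫_a^b f(t) Δt = F(b) - F(a)`, `F` an antiderivative of `f`
(and `0` if there is none; the value does not depend on the choice of `F`). -/
noncomputable def deltaIntegral (f : T → E) (a b : T) : E :=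
  if h : ∃ F : T → E, IsAntiderivative F f then h.choose b - h.choose a else 0

end Calculus

section Systems

variable {n m : ℕ}

/-- A matrix function is rd-continuous if all its entries are. -/
def MatrixRdContinuous {k l : ℕ} (M : T → Matrix (Fin k) (Fin l) ℝ) : Prop :=
  ∀ i j, RdContinuous (fun t => M t i j)

/-- `A` is regressive: `I + μ(t) A(t)` is invertible for all `t` (on a time scale without
maximum). -/
def Regressive (A : T → Matrix (Fin n) (Fin n) ℝ) : Prop :=
  ∀ t : T, IsUnit (1 + mu t • A t)

/-- `X` solves the matrix problem `X^Δ(t) = A(t) X(t)` on `T`, `X(s) = I`. -/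
def IsTransitionSolution (A : T → Matrix (Fin n) (Fin n) ℝ) (s : T)
    (X : T → Matrix (Fin n) (Fin n) ℝ) : Prop :=
  (∀ t : T, ∀ i j, HasDeltaDerivAt (fun r => X r i j) ((A t * X t) i j) t) ∧ X s = 1

open Classical in
/-- The transition matrix `Φ_A(t, s)`: the value at `t` of the solution of `X^Δ = A X`,
`X(s) = I`. -/
noncomputable def transitionMatrix (A : T → Matrix (Fin n) (Fin n) ℝ) (t s : T) :
    Matrix (Fin n) (Fin n) ℝ :=
  if h : ∃ X, IsTransitionSolution A s X then h.choose t else 0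

/-- `x` solves `x^Δ(t) = A(t) x(t) + B(t) u(t)` on `T`, `x(t₀) = x₀`. -/
def IsSystemSolution (A : T → Matrix (Fin n) (Fin n) ℝ) (B : T → Matrix (Fin n) (Fin m) ℝ)
    (u : T → Fin m → ℝ) (t₀ : T) (x₀ : Fin n → ℝ) (x : T → Fin n → ℝ) : Prop :=
  (∀ t : T, ∀ i,
    HasDeltaDerivAt (fun r => x r i) ((Matrix.mulVec (A t) (x t) + Matrix.mulVec (B t) (u t)) i) t) ∧
    x t₀ = x₀

/-- Every initial state at time `t₀` can be steered to the given final state `xf` at time `tf`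
by an rd-continuous input. -/
def ControllableTo (A : T → Matrix (Fin n) (Fin n) ℝ) (B : T → Matrix (Fin n) (Fin m) ℝ)
    (t₀ tf : T) (xf : Fin n → ℝ) : Prop :=
  ∀ x₀ : Fin n → ℝ, ∃ u : T → Fin m → ℝ, (∀ j, RdContinuous (fun t => u t j)) ∧
    ∃ x : T → Fin n → ℝ, IsSystemSolution A B u t₀ x₀ x ∧ x tf = xf

/-- Controllability on `[t₀, tf]`: every initial state can be steered to every final state. -/
def Controllable (A : T → Matrix (Fin n) (Fin n) ℝ) (B : T → Matrix (Fin n) (Fin m) ℝ)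
    (t₀ tf : T) : Prop :=
  ∀ xf : Fin n → ℝ, ControllableTo A B t₀ tf xf

/-- The integrand `Φ_A(t₀, σ(t)) B(t) Bᵀ(t) Φ_Aᵀ(t₀, σ(t))`. -/
noncomputable def gramianIntegrand (A : T → Matrix (Fin n) (Fin n) ℝ)
    (B : T → Matrix (Fin n) (Fin m) ℝ) (t₀ : T) (t : T) : Matrix (Fin n) (Fin n) ℝ :=
  transitionMatrix A t₀ (sigma t) * B t * (B t).transpose *
    (transitionMatrix A t₀ (sigma t)).transpose

/-- The controllability Gramian: the entrywise delta integral of the integrand above. -/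
noncomputable def controllabilityGramian (A : T → Matrix (Fin n) (Fin n) ℝ)
    (B : T → Matrix (Fin n) (Fin m) ℝ) (t₀ tf : T) : Matrix (Fin n) (Fin n) ℝ :=
  Matrix.of fun i j => deltaIntegral (fun t => gramianIntegrand A B t₀ t i j) t₀ tf

end Systems

end TimeScale

/-! Write `K(t) = Φ(t₀, σ(t)) B(t)`. The product rule and `Φ(t₀, ·)^Δ = -Φ(t₀, σ(·)) A` give `(Φ(t₀,
t) x(t))^Δ = K(t) u(t)`, so an input `u` steers `x₀` to `xf` exactly when `∫ K u = Φ(t₀, tf) xf -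
x₀` (`exists_isSystemSolution_eq_iff`). For fixed `xf` the right side runs through all of ℝⁿ as `x₀`
does, so for every `xf` the question is whether `u ↦ ∫ K u` is onto. If the Gramian `W = ∫ K Kᵀ` is
invertible, `u = Kᵀ W⁻¹ w` reaches `w`. If `W v = 0` with `v ≠ 0`, then `∫ |Kᵀ v|² = 0`, and by a
Cauchy–Schwarz argument no `∫ K u` equals `v` (`forall_exists_integral_mulVec_eq_iff`).

The calculus rests on one device: the delta integral of an rd-continuous `f` is the Lebesgue
integral of `f ∘ floor`. This yields antiderivatives (`RdContinuous.isAntiderivative`) and lets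
Picard iteration solve linear equations forward in time (`exists_forward_solution`). Going backward
needs regressivity: the adjoint equation `Y^Δ = -Y A (I + μ A)⁻¹` produces inverses of forward
solutions, and gluing gives `Φ` on all of `T` (`exists_isTransitionPair`). -/

namespace TimeScale

variable {T : TimeScale}

/-! ### Order and topology of a time scale -/

section Order

theorem exists_gt_of_not_bddAbove (hT : ¬ BddAbove T.carrier) (t : T) : ∃ s : T, t < s := by
  obtain ⟨s, hs, hts⟩ := not_bddAbove_iff.1 hT t
  exact ⟨⟨s, hs⟩, hts⟩

theorem le_sigma (t : T) : t ≤ sigma t := by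
  unfold sigma
  split_ifs with h
  · obtain ⟨s, hs⟩ := h
    exact le_csInf (s := {s : ℝ | s ∈ T.carrier ∧ (t : ℝ) < s}) ⟨s, s.2, hs⟩
      fun x hx => hx.2.le
  · exact le_rfl

theorem sigma_le_of_lt {t s : T} (hs : t < s) : sigma t ≤ s := by
  unfold sigma
  rw [dif_pos ⟨s, hs⟩]
  exact csInf_le (s := {s : ℝ | s ∈ T.carrier ∧ (t : ℝ) < s}) ⟨t, fun x hx => hx.2.le⟩ ⟨s.2, hs⟩

theorem mu_nonneg (t : T) : 0 ≤ mu t := sub_nonneg.2 (le_sigma t)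

theorem rightDense_or_lt_sigma (hT : ¬ BddAbove T.carrier) (t : T) :
    RightDense t ∨ t < sigma t := by
  rcases (le_sigma t).eq_or_lt with h | h
  · exact .inl ⟨exists_gt_of_not_bddAbove hT t, h.symm⟩
  · exact .inr h

theorem RightDense.exists_between {t : T} (h : RightDense t) {x : ℝ} (hx : (t : ℝ) < x) :
    ∃ s : T, t < s ∧ (s : ℝ) < x := by
  obtain ⟨⟨s, hs⟩, h2⟩ := h
  have h3 : sInf {s : ℝ | s ∈ T.carrier ∧ (t : ℝ) < s} = t := by
    have h4 := congrArg Subtype.val h2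
    unfold sigma at h4
    rwa [dif_pos ⟨s, hs⟩] at h4
  obtain ⟨y, hy, hyx⟩ := exists_lt_of_csInf_lt (s := {s : ℝ | s ∈ T.carrier ∧ (t : ℝ) < s})
    ⟨s, s.2, hs⟩ (h3.trans_lt hx)
  exact ⟨⟨y, hy.1⟩, hy.2, hyx⟩

theorem Ici_mem_nhds_of_not_leftDense {t : T} (h : ¬ LeftDense t) : Set.Ici t ∈ 𝓝 t := by
  by_cases h1 : ∃ s : T, s < t
  · have h2 : rho t ≠ t := fun h2 => h ⟨h1, h2⟩
    have h3 : ∀ s : T, s < t → s ≤ rho t := by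
      intro s hs
      unfold rho
      rw [dif_pos h1]
      exact le_csSup (s := {s : ℝ | s ∈ T.carrier ∧ s < (t : ℝ)}) ⟨t, fun x hx => hx.2.le⟩
        ⟨s.2, hs⟩
    have h4 : rho t < t := by
      refine lt_of_le_of_ne ?_ h2
      unfold rho
      rw [dif_pos h1]
      obtain ⟨s, hs⟩ := h1
      exact csSup_le (s := {s : ℝ | s ∈ T.carrier ∧ s < (t : ℝ)}) ⟨s, s.2, hs⟩
        fun x hx => hx.2.le
    filter_upwards [Ioi_mem_nhds h4] with s hs
    by_contra h5
    exact absurd (h3 s (not_le.1 h5)) (not_le.2 hs)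
  · push Not at h1
    exact Filter.mem_of_superset univ_mem fun s _ => h1 s

theorem Iic_mem_nhds_of_lt_sigma {t : T} (h : t < sigma t) : Set.Iic t ∈ 𝓝 t := by
  filter_upwards [Iio_mem_nhds h] with s hs
  by_contra h5
  exact absurd (sigma_le_of_lt (not_le.1 h5)) (not_le.2 hs)

/-- Supplies a starting time `r` from which a forward solution covers a whole neighbourhood of `t`,
even when `t` is the minimum of `T`. -/
theorem exists_le_Ici_mem_nhds (t s : T) : ∃ r, r ≤ t ∧ r ≤ s ∧ Set.Ici r ∈ 𝓝 t := by
  by_cases h : ∃ q, q < t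
  · obtain ⟨q, hq⟩ := h
    exact ⟨min q s, (min_le_left _ _).trans hq.le, min_le_right _ _,
      Filter.mem_of_superset (Ioi_mem_nhds hq) fun p hp =>
        Set.mem_Ici.2 ((min_le_left _ _).trans (Set.mem_Ioi.1 hp).le)⟩
  · push Not at h
    exact ⟨min t s, min_le_left _ _, min_le_right _ _,
      Filter.mem_of_superset univ_mem fun p _ =>
        Set.mem_Ici.2 ((min_le_left _ _).trans (h p))⟩

theorem isCompact_Icc_timeScale (a b : T) : IsCompact (Set.Icc a b) := by
  have := T.isClosed.isClosedEmbedding_subtypeVal.isCompact_preimage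
    (isCompact_Icc (a := (a : ℝ)) (b := b))
  exact this

/-- The gaps `(t, σ(t))` are disjoint nonempty open intervals. -/
theorem countable_rightScattered (T : TimeScale) : {t : T | t < sigma t}.Countable := by
  have h := countable_image_lt_image_Ioi_within T.carrier (fun x : ℝ => x)
  refine (h.preimage Subtype.val_injective).mono fun t ht => ?_
  exact ⟨t.2, sigma t, ht, fun y hy hty => sigma_le_of_lt (t := t) (s := ⟨y, hy⟩) hty⟩

end Order

/-! ### The floor map from the reals to the time scale -/

section Floor

open Classical in
/-- The largest point of `T` below `x` (and the minimum of `T` if there is none). -/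
noncomputable def floorReal (T : TimeScale) (x : ℝ) : ℝ :=
  if ∃ s : T, (s : ℝ) ≤ x then sSup {s : ℝ | s ∈ T.carrier ∧ s ≤ x} else sInf T.carrier

theorem floorReal_mem (T : TimeScale) (x : ℝ) : floorReal T x ∈ T.carrier := by
  unfold floorReal
  split_ifs with h
  · obtain ⟨s, hs⟩ := h
    exact closure_minimal (fun x hx => hx.1) T.isClosed
      (csSup_mem_closure (s := {s : ℝ | s ∈ T.carrier ∧ s ≤ x}) ⟨s, s.2, hs⟩ ⟨x, fun y hy => hy.2⟩)
  · push Not at h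
    exact T.isClosed.csInf_mem T.nonempty ⟨x, fun y hy => (h ⟨y, hy⟩).le⟩

/-- The largest point of `T` below `x` (and the minimum of `T` if there is none). -/
noncomputable def floor (T : TimeScale) (x : ℝ) : T := ⟨floorReal T x, floorReal_mem T x⟩

theorem le_floor {t : T} {x : ℝ} (h : (t : ℝ) ≤ x) : t ≤ floor T x := by
  change (t : ℝ) ≤ floorReal T x
  unfold floorReal
  rw [if_pos ⟨t, h⟩]
  exact le_csSup (s := {s : ℝ | s ∈ T.carrier ∧ s ≤ x}) ⟨x, fun y hy => hy.2⟩ ⟨t.2, h⟩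

theorem floor_le {t : T} {x : ℝ} (h : (t : ℝ) ≤ x) : (floor T x : ℝ) ≤ x := by
  change floorReal T x ≤ x
  unfold floorReal
  rw [if_pos ⟨t, h⟩]
  exact csSup_le (s := {s : ℝ | s ∈ T.carrier ∧ s ≤ x}) ⟨t, t.2, h⟩ fun y hy => hy.2

/-- Hence `f ∘ floor` is constant on each gap, with the value of `f` at its left end. -/
theorem floor_eq {t : T} {x : ℝ} (h : (t : ℝ) ≤ x) (h2 : x < sigma t) : floor T x = t := by
  refine le_antisymm ?_ (le_floor h)
  by_contra h3
  have h4 : (sigma t : ℝ) ≤ floor T x := sigma_le_of_lt (not_le.1 h3)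
  exact absurd (h4.trans (floor_le h)) (not_le.2 h2)

theorem floor_mono (T : TimeScale) : Monotone (floor T) := by
  intro x y hxy
  by_cases h : ∃ s : T, (s : ℝ) ≤ x
  · obtain ⟨s, hs⟩ := h
    exact le_floor ((floor_le hs).trans hxy)
  · have h1 : (floor T x : ℝ) = sInf T.carrier := if_neg h
    push Not at h
    change (floor T x : ℝ) ≤ floor T y
    rw [h1]
    exact csInf_le ⟨x, fun y hy => (h ⟨y, hy⟩).le⟩ (floor T y).2

theorem measurable_floor (T : TimeScale) : Measurable (floor T) := by
  refine Measurable.subtype_mk (Monotone.measurable (f := floorReal T) ?_)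
  exact fun x y hxy => floor_mono T hxy

end Floor

/-! ### Rd-continuous functions and their integrals -/

section RdContinuous

variable {E F G : Type*} [NormedAddCommGroup E] [NormedAddCommGroup F] [NormedAddCommGroup G]

theorem _root_.Continuous.rdContinuous {f : T → E} (hf : Continuous f) : RdContinuous f :=
  ⟨fun _ _ => hf.continuousAt, fun t _ => ⟨f t, hf.continuousAt.mono_left nhdsWithin_le_nhds⟩⟩

theorem RdContinuous.comp_continuous {f : T → E} (hf : RdContinuous f) {φ : E → F}
    (hφ : Continuous φ) : RdContinuous fun t => φ (f t) := by
  refine ⟨fun t ht => hφ.continuousAt.comp (hf.1 t ht), fun t ht => ?_⟩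
  obtain ⟨l, hl⟩ := hf.2 t ht
  exact ⟨φ l, (hφ.tendsto l).comp hl⟩

theorem RdContinuous.prodMk {f : T → E} {g : T → F} (hf : RdContinuous f)
    (hg : RdContinuous g) : RdContinuous fun t => (f t, g t) := by
  refine ⟨fun t ht => (hf.1 t ht).prodMk (hg.1 t ht), fun t ht => ?_⟩
  obtain ⟨l, hl⟩ := hf.2 t ht
  obtain ⟨l', hl'⟩ := hg.2 t ht
  exact ⟨(l, l'), hl.prodMk_nhds hl'⟩

theorem RdContinuous.comp_continuous₂ {f : T → E} {g : T → F} (hf : RdContinuous f)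
    (hg : RdContinuous g) {φ : E × F → G} (hφ : Continuous φ) :
    RdContinuous fun t => φ (f t, g t) :=
  (hf.prodMk hg).comp_continuous hφ

/-- By compactness local bounds suffice. They come from continuity at right-dense points; elsewhere
from the left limit, if `t` is left-dense, and the value at `t`. -/
theorem RdContinuous.exists_norm_le (hT : ¬ BddAbove T.carrier) {f : T → E}
    (hf : RdContinuous f) (a b : T) : ∃ M, ∀ t, a ≤ t → t ≤ b → ‖f t‖ ≤ M := by
  suffices h : ∃ M, ∀ t ∈ Set.Icc a b, ‖f t‖ ≤ M by
    obtain ⟨M, hM⟩ := h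
    exact ⟨M, fun t h1 h2 => hM t ⟨h1, h2⟩⟩
  refine (isCompact_Icc_timeScale a b).induction_on (p := fun s => ∃ M, ∀ t ∈ s, ‖f t‖ ≤ M)
    ⟨0, by simp⟩ (fun s t hst ⟨M, hM⟩ => ⟨M, fun x hx => hM x (hst hx)⟩) ?_ ?_
  · rintro s t ⟨M, hM⟩ ⟨N, hN⟩
    refine ⟨max M N, fun x hx => ?_⟩
    rcases hx with hx | hx
    · exact (hM x hx).trans (le_max_left _ _)
    · exact (hN x hx).trans (le_max_right _ _)
  · intro t _
    suffices h : ∃ M, ∀ᶠ s in 𝓝 t, ‖f s‖ ≤ M by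
      obtain ⟨M, hM⟩ := h
      exact ⟨_, mem_nhdsWithin_of_mem_nhds hM, M, fun x hx => hx⟩
    rcases rightDense_or_lt_sigma hT t with h | h
    · refine ⟨‖f t‖ + 1, ?_⟩
      filter_upwards [(hf.1 t h).norm.eventually_lt_const (lt_add_one _)] with s hs using hs.le
    · by_cases h1 : LeftDense t
      · obtain ⟨l, hl⟩ := hf.2 t h1
        refine ⟨max (‖l‖ + 1) ‖f t‖, ?_⟩
        have h2 := hl.norm.eventually_lt_const (lt_add_one _)
        filter_upwards [eventually_nhdsWithin_iff.1 h2, Iic_mem_nhds_of_lt_sigma h] with s hs hst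
        rcases (Set.mem_Iic.1 hst).lt_or_eq with h3 | h3
        · exact (hs h3).le.trans (le_max_left _ _)
        · rw [h3]; exact le_max_right _ _
      · refine ⟨‖f t‖, ?_⟩
        filter_upwards [Ici_mem_nhds_of_not_leftDense h1, Iic_mem_nhds_of_lt_sigma h] with s h2 h3
        rw [le_antisymm (Set.mem_Iic.1 h3) (Set.mem_Ici.1 h2)]

/-- The preimage of an open set is open up to points of discontinuity, which are right-scattered and
so countably many. -/
theorem RdContinuous.measurable (hT : ¬ BddAbove T.carrier) [MeasurableSpace E] [BorelSpace E]
    {f : T → E} (hf : RdContinuous f) : Measurable f := by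
  refine measurable_of_isOpen fun U hU => ?_
  have h : f ⁻¹' U = interior (f ⁻¹' U) ∪ (f ⁻¹' U \ interior (f ⁻¹' U)) :=
    (Set.union_sdiff_cancel interior_subset).symm
  rw [h]
  refine isOpen_interior.measurableSet.union (Set.Countable.measurableSet ?_)
  refine (countable_rightScattered T).mono fun t ht => ?_
  refine (rightDense_or_lt_sigma hT t).resolve_left fun h1 => ht.2 ?_
  exact mem_interior_iff_mem_nhds.2 ((hf.1 t h1).preimage_mem_nhds (hU.mem_nhds ht.1))

theorem RdContinuous.intervalIntegrable_floor [SecondCountableTopology E]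
    (hT : ¬ BddAbove T.carrier) {f : T → E}
    (hf : RdContinuous f) (a b : T) :
    IntervalIntegrable (fun x => f (floor T x)) MeasureTheory.volume a b := by
  borelize E
  wlog hab : a ≤ b generalizing a b
  · exact (this b a (le_of_not_ge hab)).symm
  obtain ⟨M, hM⟩ := hf.exists_norm_le hT a b
  refine (intervalIntegrable_const (c := M)).mono_fun
    ((hf.measurable hT).comp (measurable_floor T)).aestronglyMeasurable ?_
  filter_upwards [MeasureTheory.ae_restrict_mem measurableSet_uIoc] with x hx
  rw [Set.uIoc_of_le (show (a : ℝ) ≤ b from hab)] at hx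
  refine (hM _ (le_floor hx.1.le) ?_).trans (le_abs_self M)
  exact (floor_le hx.1.le).trans hx.2

variable [NormedSpace ℝ E]

/-- The delta integral of an rd-continuous function, as a Lebesgue integral. -/
noncomputable def lebesgueDeltaIntegral (f : T → E) (a b : T) : E :=
  ∫ x in (a : ℝ)..b, f (floor T x)

theorem lebesgueDeltaIntegral_add [SecondCountableTopology E]
    (hT : ¬ BddAbove T.carrier) {f : T → E} (hf : RdContinuous f) (a b c : T) :
    lebesgueDeltaIntegral f a b + lebesgueDeltaIntegral f b c = lebesgueDeltaIntegral f a c :=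
  intervalIntegral.integral_add_adjacent_intervals (hf.intervalIntegrable_floor hT a b)
    (hf.intervalIntegrable_floor hT b c)

variable [CompleteSpace E]

theorem lebesgueDeltaIntegral_sigma (f : T → E) (t : T) :
    lebesgueDeltaIntegral f t (sigma t) = mu t • f t := by
  have h : (t : ℝ) ≤ sigma t := le_sigma t
  rw [mu, lebesgueDeltaIntegral, ← intervalIntegral.integral_const]
  refine intervalIntegral.integral_congr_ae ?_
  -- The floor is `t` on the gap except at its right end, a null set.
  have h1 : ∀ᵐ x : ℝ, x ≠ sigma t := by
    simp [MeasureTheory.ae_iff]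
  filter_upwards [h1] with x hx hx2
  rw [Set.uIoc_of_le h] at hx2
  rw [floor_eq hx2.1.le (lt_of_le_of_ne hx2.2 hx)]

variable [SecondCountableTopology E]

theorem norm_lebesgueDeltaIntegral_sub_le (hT : ¬ BddAbove T.carrier) {f : T → E}
    (hf : RdContinuous f) {a b : T} {c : E} {ε : ℝ}
    (h : ∀ t, min a b ≤ t → t ≤ max a b → ‖f t - c‖ ≤ ε) :
    ‖lebesgueDeltaIntegral f a b - ((b : ℝ) - a) • c‖ ≤ ε * |(b : ℝ) - a| := by
  rw [lebesgueDeltaIntegral, ← intervalIntegral.integral_const,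
    ← intervalIntegral.integral_sub (hf.intervalIntegrable_floor hT a b)
      intervalIntegrable_const]
  refine intervalIntegral.norm_integral_le_of_norm_le_const fun x hx => ?_
  have h1 : ((min a b : T) : ℝ) = min (a : ℝ) b := (Subtype.mono_coe _).map_min
  have h2 : ((max a b : T) : ℝ) = max (a : ℝ) b := (Subtype.mono_coe _).map_max
  have h3 : ((min a b : T) : ℝ) ≤ x := h1 ▸ hx.1.le
  exact h _ (le_floor h3) ((floor_le h3).trans (h2 ▸ hx.2))

/-- The jump contributes exactly `μ(t) f(t)`, which leaves the integral between `s` and `t`. At a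
right-dense point continuity controls it. At a right-scattered point a bound to the left of `t`
suffices, since `|σ(t) - s|` stays at least `μ(t) > 0`. -/
theorem RdContinuous.isAntiderivative (hT : ¬ BddAbove T.carrier) {f : T → E}
    (hf : RdContinuous f) (a : T) : IsAntiderivative (lebesgueDeltaIntegral f a) f := by
  intro t ε hε
  have hadd : ∀ s, lebesgueDeltaIntegral f a (sigma t) - lebesgueDeltaIntegral f a s =
      mu t • f t + lebesgueDeltaIntegral f s t := by
    intro s
    rw [← lebesgueDeltaIntegral_sigma, add_comm, lebesgueDeltaIntegral_add hT hf,
      ← lebesgueDeltaIntegral_add hT hf a s, add_sub_cancel_left]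
  have hkey : ∀ s, lebesgueDeltaIntegral f a (sigma t) - lebesgueDeltaIntegral f a s -
      ((sigma t : ℝ) - s) • f t = lebesgueDeltaIntegral f s t - ((t : ℝ) - s) • f t := by
    intro s
    rw [hadd, show (sigma t : ℝ) - s = mu t + ((t : ℝ) - s) by unfold mu; ring, add_smul]
    abel
  rcases rightDense_or_lt_sigma hT t with h | h
  · obtain ⟨δ, hδ, hb⟩ := Metric.continuousAt_iff.1 (hf.1 t h) ε hε
    filter_upwards [Metric.ball_mem_nhds t hδ] with s hs
    rw [hkey, h.2]
    refine norm_lebesgueDeltaIntegral_sub_le hT hf fun p h1 h2 => ?_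
    rw [← dist_eq_norm]
    refine (hb ?_).le
    rw [Metric.mem_ball, Subtype.dist_eq, Real.dist_eq, abs_lt] at hs
    rw [Subtype.dist_eq, Real.dist_eq, abs_lt]
    have h1' : min (s : ℝ) t ≤ p := (Subtype.mono_coe _).map_min (a := s) (b := t) ▸ h1
    have h2' : (p : ℝ) ≤ max (s : ℝ) t := (Subtype.mono_coe _).map_max (a := s) (b := t) ▸ h2
    rcases min_le_iff.1 h1' with h3 | h3 <;> rcases le_max_iff.1 h2' with h4 | h4 <;>
      constructor <;> linarith
  · obtain ⟨r, hrt, -, hr⟩ := exists_le_Ici_mem_nhds t t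
    obtain ⟨M, hM⟩ := hf.exists_norm_le hT r t
    have hMt : 0 ≤ M := (norm_nonneg _).trans (hM t hrt le_rfl)
    have hμ : 0 < mu t := sub_pos.2 (show (t : ℝ) < sigma t from h)
    have hcont : ∀ᶠ s : T in 𝓝 t, (M + ‖f t‖) * |(t : ℝ) - s| < ε * mu t := by
      have hc : ContinuousAt (fun s : T => (M + ‖f t‖) * |(t : ℝ) - s|) t := by fun_prop
      refine hc.eventually_lt_const ?_
      simp only [sub_self, abs_zero, mul_zero]
      positivity
    filter_upwards [hr, Iic_mem_nhds_of_lt_sigma h, hcont] with s h1 h2 h3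
    rw [hkey]
    have h2' : (s : ℝ) ≤ t := h2
    have h4 : mu t ≤ |(sigma t : ℝ) - s| := by
      refine le_trans ?_ (le_abs_self _)
      unfold mu
      linarith
    refine (norm_lebesgueDeltaIntegral_sub_le hT hf (ε := M + ‖f t‖) fun p h5 h6 => ?_).trans
      (h3.le.trans (by gcongr))
    rw [min_eq_left h2] at h5
    rw [max_eq_right h2] at h6
    exact (norm_sub_le _ _).trans (by gcongr; exact hM p (h1.trans h5) h6)

end RdContinuous

/-! ### Rules for the delta derivative -/

section Derivative

variable {E F G : Type*} [NormedAddCommGroup E] [NormedSpace ℝ E]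
  [NormedAddCommGroup F] [NormedSpace ℝ F] [NormedAddCommGroup G] [NormedSpace ℝ G]

theorem hasDeltaDerivAt_iff_isLittleO {f : T → E} {f' : E} {t : T} :
    HasDeltaDerivAt f f' t ↔
      (fun s : T => f (sigma t) - f s - ((sigma t : ℝ) - s) • f') =o[𝓝 t]
        fun s : T => (sigma t : ℝ) - s := by
  simp only [HasDeltaDerivAt, Asymptotics.isLittleO_iff, Real.norm_eq_abs]

/-- Put `s = t` in the definition and let `ε` tend to zero. -/
theorem HasDeltaDerivAt.sigma_eq {f : T → E} {f' : E} {t : T} (h : HasDeltaDerivAt f f' t) :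
    f (sigma t) = f t + mu t • f' := by
  have h1 : ∀ ε : ℝ, 0 < ε → ‖f (sigma t) - f t - mu t • f'‖ ≤ ε * |mu t| :=
    fun ε hε => (h ε hε).self_of_nhds
  have h2 : ‖f (sigma t) - f t - mu t • f'‖ ≤ 0 := by
    refine le_of_forall_pos_le_add fun ε hε => ?_
    refine (h1 (ε / (|mu t| + 1)) (by positivity)).trans ?_
    rw [div_mul_eq_mul_div, zero_add, div_le_iff₀ (by positivity)]
    nlinarith [abs_nonneg (mu t)]
  rw [norm_le_zero_iff, sub_sub, sub_eq_zero] at h2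
  exact h2

theorem HasDeltaDerivAt.continuousAt {f : T → E} {f' : E} {t : T} (h : HasDeltaDerivAt f f' t) :
    ContinuousAt f t := by
  have h1 := h 1 one_pos
  have h2 : Tendsto (fun s : T => f (sigma t) - f s - ((sigma t : ℝ) - s) • f') (𝓝 t)
      (𝓝 (f (sigma t) - f t - mu t • f')) := by
    rw [show f (sigma t) - f t - mu t • f' = 0 by rw [h.sigma_eq, add_sub_cancel_left, sub_self]]
    by_cases hμ : mu t = 0
    · refine squeeze_zero_norm' h1 ?_
      have : ContinuousAt (fun s : T => 1 * |(sigma t : ℝ) - s|) t := by fun_prop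
      have h3 := this.tendsto
      rwa [show (sigma t : ℝ) - t = 0 from hμ, abs_zero, mul_zero] at h3
    · rw [Metric.tendsto_nhds]
      intro ε hε
      have hc : ContinuousAt (fun s : T => |(sigma t : ℝ) - s|) t := by fun_prop
      have h4 := hc.eventually_lt_const (show |(sigma t : ℝ) - t| < |mu t| + 1 from
        lt_add_one _)
      filter_upwards [h (ε / (|mu t| + 1)) (by positivity), h4] with s h5 h6
      rw [dist_zero_right]
      refine h5.trans_lt ?_
      rw [div_mul_eq_mul_div, div_lt_iff₀ (by positivity)]
      gcongr
  have h3 : Tendsto (fun s : T => ((sigma t : ℝ) - s) • f') (𝓝 t) (𝓝 (mu t • f')) := by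
    have : ContinuousAt (fun s : T => ((sigma t : ℝ) - s) • f') t := by fun_prop
    exact this
  have h4 := (tendsto_const_nhds (x := f (sigma t))).sub (h2.add h3)
  simpa [ContinuousAt] using h4

theorem HasDeltaDerivAt.congr_of_eventuallyEq {f g : T → E} {f' : E} {t : T}
    (h : HasDeltaDerivAt f f' t) (h1 : g =ᶠ[𝓝 t] f) (h2 : g (sigma t) = f (sigma t)) :
    HasDeltaDerivAt g f' t := by
  intro ε hε
  filter_upwards [h ε hε, h1] with s hs hs1
  rwa [h2, hs1]

theorem hasDeltaDerivAt_const (c : E) (t : T) : HasDeltaDerivAt (fun _ => c) 0 t := by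
  intro ε hε
  refine .of_forall fun s => ?_
  simp only [sub_self, smul_zero, norm_zero]
  positivity

theorem HasDeltaDerivAt.add {f g : T → E} {f' g' : E} {t : T} (hf : HasDeltaDerivAt f f' t)
    (hg : HasDeltaDerivAt g g' t) : HasDeltaDerivAt (fun s => f s + g s) (f' + g') t := by
  rw [hasDeltaDerivAt_iff_isLittleO] at *
  refine (hf.add hg).congr_left fun s => ?_
  rw [smul_add]
  abel

theorem HasDeltaDerivAt.clm_apply {f : T → E} {f' : E} {t : T} (hf : HasDeltaDerivAt f f' t)
    (L : E →L[ℝ] F) : HasDeltaDerivAt (fun s => L (f s)) (L f') t := by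
  rw [hasDeltaDerivAt_iff_isLittleO] at *
  refine ((L.isBigO_comp _ _).trans_isLittleO hf).congr_left fun s => ?_
  simp

theorem HasDeltaDerivAt.sum {ι : Type*} {S : Finset ι} {f : ι → T → E} {f' : ι → E} {t : T}
    (h : ∀ i ∈ S, HasDeltaDerivAt (f i) (f' i) t) :
    HasDeltaDerivAt (fun s => ∑ i ∈ S, f i s) (∑ i ∈ S, f' i) t := by
  classical
  induction S using Finset.induction_on with
  | empty => simpa using hasDeltaDerivAt_const (0 : E) t
  | insert i S hi ih =>
    simp only [Finset.sum_insert hi]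
    exact (h i (Finset.mem_insert_self _ _)).add
      (ih fun j hj => h j (Finset.mem_insert_of_mem hj))

/-- The product rule `(fg)^Δ = f^Δ g^σ + f g^Δ` for a continuous bilinear product. -/
theorem HasDeltaDerivAt.bilinear (B : E →L[ℝ] F →L[ℝ] G) {f : T → E} {g : T → F} {f' : E}
    {g' : F} {t : T} (hf : HasDeltaDerivAt f f' t) (hg : HasDeltaDerivAt g g' t) :
    HasDeltaDerivAt (fun s => B (f s) (g s)) (B f' (g (sigma t)) + B (f t) g') t := by
  have hfc := hf.continuousAt
  rw [hasDeltaDerivAt_iff_isLittleO] at *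
  -- The remainder of the product is the remainder of `f` paired with `g(σ(t))`, plus `f(s)` paired
  -- with the remainder of `g`, plus `(σ(t) - s) B(f(s) - f(t)) g'`.
  have h1 := ((B.flip (g (sigma t))).isBigO_comp _ _).trans_isLittleO hf
  have hB : ∀ (u : T → E) (v : T → F), (fun s => B (u s) (v s)) =O[𝓝 t]
      fun s => ‖u s‖ * ‖v s‖ := fun u v =>
    Asymptotics.IsBigO.of_bound ‖B‖ (.of_forall fun s => by
      simpa [mul_assoc] using B.le_opNorm₂ (u s) (v s))
  have h2 : (fun s : T => B (f s) (g (sigma t) - g s - ((sigma t : ℝ) - s) • g')) =o[𝓝 t]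
      fun s : T => (sigma t : ℝ) - s := by
    refine (hB _ _).trans_isLittleO ?_
    have := (hfc.norm.isBigO_one ℝ).mul_isLittleO hg.norm_left
    simpa using this
  have h3 : (fun s : T => ((sigma t : ℝ) - s) • B (f s - f t) g') =o[𝓝 t]
      fun s : T => (sigma t : ℝ) - s := by
    have h4 : Tendsto (fun s : T => B (f s - f t) g') (𝓝 t) (𝓝 0) := by
      have : ContinuousAt (fun s : T => B.flip g' (f s - f t)) t := by fun_prop
      simpa [ContinuousAt] using this
    have := (Asymptotics.isBigO_refl (fun s : T => (sigma t : ℝ) - s) (𝓝 t)).smul_isLittleO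
      ((Asymptotics.isLittleO_one_iff ℝ).2 h4)
    simpa using this
  refine ((h1.add h2).add h3).congr_left fun s => ?_
  simp only [ContinuousLinearMap.flip_apply, map_sub, map_smul, sub_apply,
    smul_sub, smul_add]
  abel

theorem HasDeltaDerivAt.mul {f g : T → ℝ} {f' g' : ℝ} {t : T} (hf : HasDeltaDerivAt f f' t)
    (hg : HasDeltaDerivAt g g' t) :
    HasDeltaDerivAt (fun s => f s * g s) (f' * g (sigma t) + f t * g') t :=
  hf.bilinear (ContinuousLinearMap.mul ℝ ℝ) hg

theorem HasDeltaDerivAt.mulVec {k l : ℕ} {M : T → Matrix (Fin k) (Fin l) ℝ}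
    {x : T → Fin l → ℝ} {M' : Matrix (Fin k) (Fin l) ℝ} {x' : Fin l → ℝ} {t : T}
    (hM : ∀ i j, HasDeltaDerivAt (fun s => M s i j) (M' i j) t)
    (hx : ∀ j, HasDeltaDerivAt (fun s => x s j) (x' j) t) (i : Fin k) :
    HasDeltaDerivAt (fun s => (M s).mulVec (x s) i)
      ((M'.mulVec (x t) + (M (sigma t)).mulVec x') i) t := by
  simp only [Pi.add_apply, Matrix.mulVec, dotProduct, ← Finset.sum_add_distrib]
  refine HasDeltaDerivAt.sum fun j _ => ?_
  -- With `x` as the first factor, `σ` falls on `M`.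
  have h := (hx j).mul (hM i j)
  simp only [mul_comm (x _ j), mul_comm (x' j)] at h
  rwa [add_comm] at h

end Derivative

/-! ### Monotonicity and uniqueness of antiderivatives -/

section MeanValue

/-- Induction along `T`: let `c` be the supremum of the points of `[a, b]` where `F a ≤ F t + ε (t -
a)`. Continuity puts `c` among them. If `c < b`, a further point is reached, by the jump if `c` is
right-scattered, and otherwise by the derivative estimate, whose error the slack `ε` absorbs. -/
theorem le_of_hasDeltaDerivAt_nonneg (hT : ¬ BddAbove T.carrier) {F : T → ℝ} {f : T → ℝ}
    {a b : T} (hab : a ≤ b)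
    (hF : ∀ t, a ≤ t → t ≤ b → HasDeltaDerivAt F (f t) t)
    (hf : ∀ t, a ≤ t → t < b → 0 ≤ f t) : F a ≤ F b := by
  suffices h : ∀ ε : ℝ, 0 < ε → F a ≤ F b + ε * ((b : ℝ) - a) by
    refine le_of_forall_pos_le_add fun ε hε => ?_
    have hab' : (0 : ℝ) ≤ (b : ℝ) - a := sub_nonneg.2 hab
    refine (h (ε / ((b : ℝ) - a + 1)) (by positivity)).trans ?_
    gcongr
    rw [div_mul_eq_mul_div, div_le_iff₀ (by positivity)]
    nlinarith
  intro ε hε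
  let P : T → Prop := fun t => F a ≤ F t + ε * ((t : ℝ) - a)
  change P b
  have hPc : ∀ t, a ≤ t → t ≤ b → ContinuousAt
      (fun s : T => F s + ε * ((s : ℝ) - a)) t := fun t h1 h2 => by
    have := (hF t h1 h2).continuousAt
    fun_prop
  let S : Set ℝ := {x | ∃ t : T, (t : ℝ) = x ∧ a ≤ t ∧ t ≤ b ∧ P t}
  have hSne : S.Nonempty := ⟨a, a, rfl, le_rfl, hab, by simp [P]⟩
  have hSb : BddAbove S := ⟨b, by rintro x ⟨t, rfl, -, h, -⟩; exact h⟩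
  have hmem : sSup S ∈ closure S := csSup_mem_closure hSne hSb
  have hcT : sSup S ∈ T.carrier :=
    closure_minimal (by rintro x ⟨t, rfl, -⟩; exact t.2) T.isClosed hmem
  obtain ⟨c, hc⟩ : ∃ c : T, (c : ℝ) = sSup S := ⟨⟨_, hcT⟩, rfl⟩
  have hac : a ≤ c := by
    change (a : ℝ) ≤ c
    rw [hc]
    exact le_csSup hSb ⟨a, rfl, le_rfl, hab, by simp [P]⟩
  have hcb : c ≤ b := by
    change (c : ℝ) ≤ b
    rw [hc]
    exact csSup_le hSne (by rintro x ⟨t, rfl, -, h, -⟩; exact h)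
  have hle : ∀ t, a ≤ t → t ≤ b → P t → t ≤ c := fun t h1 h2 h3 => by
    change (t : ℝ) ≤ c
    rw [hc]
    exact le_csSup hSb ⟨t, rfl, h1, h2, h3⟩
  have hPcc : P c := by
    by_contra hn
    have hev : ∀ᶠ s : T in 𝓝 c, F s + ε * ((s : ℝ) - a) < F a :=
      (hPc c hac hcb).eventually_lt_const (not_le.1 hn)
    obtain ⟨δ, hδ, hball⟩ := Metric.eventually_nhds_iff.1 hev
    obtain ⟨x, ⟨t, rfl, h1, h2, h3⟩, h4⟩ := exists_lt_of_lt_csSup hSne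
      (show sSup S - δ < sSup S by linarith)
    have h5 : (t : ℝ) ≤ c := hle t h1 h2 h3
    refine absurd (hball (y := t) ?_) (not_lt.2 h3)
    rw [Subtype.dist_eq, Real.dist_eq, abs_lt, hc] at *
    constructor <;> linarith
  rcases hcb.eq_or_lt with h | h
  · rwa [← h]
  exfalso
  have hd := hF c hac hcb
  have hf0 := hf c hac h
  rcases rightDense_or_lt_sigma hT c with h1 | h1
  · obtain ⟨δ, hδ, hball⟩ := Metric.eventually_nhds_iff.1 (hd ε hε)
    obtain ⟨s, hs, hs2⟩ := h1.exists_between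
      (show (c : ℝ) < min (b : ℝ) (c + δ) from lt_min h (by linarith))
    have hs' : (c : ℝ) < s := hs
    have h3 := hball (y := s) (by
      rw [Subtype.dist_eq, Real.dist_eq, abs_lt]
      have := hs2.trans_le (min_le_right _ _)
      constructor <;> linarith)
    rw [h1.2, Real.norm_eq_abs, abs_of_neg (show (c : ℝ) - s < 0 by linarith), smul_eq_mul] at h3
    have h4 := (abs_le.1 h3).2
    have h5 : P c := hPcc
    refine absurd (hle s (hac.trans hs.le) (hs2.trans_le (min_le_left _ _)).le ?_) (not_le.2 hs)
    simp only [P] at h5 ⊢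
    nlinarith
  · have h3 := hd.sigma_eq
    refine absurd (hle (sigma c) (hac.trans h1.le) (sigma_le_of_lt h) ?_) (not_le.2 h1)
    have h5 : P c := hPcc
    simp only [P] at h5 ⊢
    have h6 : 0 ≤ mu c * f c := mul_nonneg (mu_nonneg c) hf0
    have h7 : (sigma c : ℝ) = c + mu c := by unfold mu; ring
    rw [h3, h7, smul_eq_mul]
    nlinarith [mul_nonneg hε.le (mu_nonneg c)]

theorem eq_of_hasDeltaDerivAt_zero_real (hT : ¬ BddAbove T.carrier) {F : T → ℝ} {a b : T}
    (hab : a ≤ b) (hF : ∀ t, a ≤ t → t ≤ b → HasDeltaDerivAt F 0 t) : F b = F a := by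
  refine le_antisymm ?_ (le_of_hasDeltaDerivAt_nonneg hT hab hF fun _ _ _ => le_rfl)
  have h := le_of_hasDeltaDerivAt_nonneg hT (F := fun t => -F t) (f := fun _ => 0) hab
    (fun t h1 h2 => by
      simpa using (hF t h1 h2).clm_apply (-ContinuousLinearMap.id ℝ ℝ)) fun _ _ _ => le_rfl
  exact neg_le_neg_iff.1 h

/-- Continuous functionals separate points, so the real case suffices. -/
theorem eq_of_hasDeltaDerivAt_zero {E : Type*} [NormedAddCommGroup E] [NormedSpace ℝ E]
    (hT : ¬ BddAbove T.carrier) {F : T → E} {a b : T}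
    (hab : a ≤ b) (hF : ∀ t, a ≤ t → t ≤ b → HasDeltaDerivAt F 0 t) : F b = F a :=
  (SeparatingDual.eq_iff_forall_dual_eq (R := ℝ)).2 fun g =>
    eq_of_hasDeltaDerivAt_zero_real hT (F := fun t => g (F t)) hab fun t h1 h2 => by
      simpa using (hF t h1 h2).clm_apply g

theorem IsAntiderivative.sub_eq_sub (hT : ¬ BddAbove T.carrier) {F G f : T → ℝ}
    (hF : IsAntiderivative F f) (hG : IsAntiderivative G f) {a b : T} (hab : a ≤ b) :
    F b - F a = G b - G a := by
  have h := eq_of_hasDeltaDerivAt_zero_real hT (F := fun t => F t + -G t) hab fun t _ _ => by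
    simpa using (hF t).add ((hG t).clm_apply (-ContinuousLinearMap.id ℝ ℝ))
  linarith

theorem IsAntiderivative.deltaIntegral_eq (hT : ¬ BddAbove T.carrier) {F f : T → ℝ}
    (hF : IsAntiderivative F f) {a b : T} (hab : a ≤ b) : deltaIntegral f a b = F b - F a := by
  have h : ∃ F : T → ℝ, IsAntiderivative F f := ⟨F, hF⟩
  rw [deltaIntegral, dif_pos h]
  exact h.choose_spec.sub_eq_sub hT hF hab

end MeanValue

/-! ### Picard iteration forward in time -/

section LinearEquation

variable {E : Type*} [NormedAddCommGroup E] [NormedSpace ℝ E]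

theorem RdContinuous.clm_apply {F G : Type*} [NormedAddCommGroup F] [NormedSpace ℝ F]
    [NormedAddCommGroup G] [NormedSpace ℝ G] {L : T → F →L[ℝ] G} (hL : RdContinuous L) {f : T → F}
    (hf : RdContinuous f) : RdContinuous fun t => L t (f t) :=
  hL.comp_continuous₂ hf (φ := fun p => p.1 p.2) (by fun_prop)

/-- The Picard iterates for `x^Δ = L x`, `x(r) = x₀` to the right of `r`, stopped at `r`. -/
noncomputable def picardTerm (L : T → E →L[ℝ] E) (r : T) (x₀ : E) : ℕ → T → E
  | 0 => fun _ => x₀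
  | k + 1 => fun t => lebesgueDeltaIntegral (fun s => L s (picardTerm L r x₀ k s)) r (max t r)

variable {L : T → E →L[ℝ] E}

/-- Integrating `K exp(2K(x - r))` gains a factor `1/2`, so the exponential weight gives geometric
decay on intervals of any length. -/
theorem norm_picardTerm_le {r b : T} (x₀ : E)
    {K : ℝ} (hK : 0 < K) (hb : ∀ t, r ≤ t → t ≤ b → ‖L t‖ ≤ K) (k : ℕ) {t : T} (hrt : r ≤ t)
    (htb : t ≤ b) :
    ‖picardTerm L r x₀ k t‖ ≤ ‖x₀‖ * (1 / 2) ^ k * Real.exp (2 * K * ((t : ℝ) - r)) := by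
  induction k generalizing t with
  | zero =>
    have hrt' : (0 : ℝ) ≤ (t : ℝ) - r := sub_nonneg.2 hrt
    simp only [picardTerm, pow_zero, mul_one]
    exact le_mul_of_one_le_right (norm_nonneg _) (Real.one_le_exp (by positivity))
  | succ k ih =>
    have hrt' : (r : ℝ) ≤ t := hrt
    simp only [picardTerm, max_eq_left hrt, lebesgueDeltaIntegral]
    have hint : ∀ x : ℝ, HasDerivAt
        (fun x : ℝ => ‖x₀‖ * (1 / 2) ^ (k + 1) * Real.exp (2 * K * (x - r)))
        (K * (‖x₀‖ * (1 / 2) ^ k * Real.exp (2 * K * (x - r)))) x := fun x => by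
      have h1 : HasDerivAt (fun x : ℝ => 2 * K * (x - r)) (2 * K * 1) x :=
        ((hasDerivAt_id x).sub_const _).const_mul _
      exact (h1.exp.const_mul (‖x₀‖ * (1 / 2) ^ (k + 1))).congr_deriv (by ring)
    have hc : Continuous fun x : ℝ => K * (‖x₀‖ * (1 / 2) ^ k * Real.exp (2 * K * (x - r))) := by
      fun_prop
    refine (intervalIntegral.norm_integral_le_of_norm_le hrt' (.of_forall fun x hx => ?_)
      (hc.intervalIntegrable _ _)).trans ?_
    · have h1 := le_floor hx.1.le
      have h2 : (floor T x : ℝ) ≤ x := floor_le hx.1.le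
      have h3 : floor T x ≤ b := (h2.trans hx.2).trans htb
      refine (ContinuousLinearMap.le_opNorm _ _).trans ?_
      refine mul_le_mul (hb _ h1 h3) ((ih h1 h3).trans ?_) (norm_nonneg _) hK.le
      gcongr
    · rw [intervalIntegral.integral_eq_sub_of_hasDerivAt (fun x _ => hint x)
        (hc.intervalIntegrable _ _)]
      exact sub_le_self _ (by positivity)

/-- Stopping at `r` makes the terms to its left equal to those at `r`, so one constant serves all `t
≤ b`. -/
theorem exists_picard_bound (hT : ¬ BddAbove T.carrier) (hL : RdContinuous L) (r b : T) (x₀ : E) :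
    ∃ C, ∀ k t, t ≤ b → ‖picardTerm L r x₀ k t‖ ≤ C * (1 / 2) ^ k := by
  obtain ⟨K, hK⟩ := hL.exists_norm_le hT r (max b r)
  refine ⟨‖x₀‖ * Real.exp (2 * max K 1 * ((max b r : T) - r)), fun k t htb => ?_⟩
  have hmax : picardTerm L r x₀ k t = picardTerm L r x₀ k (max t r) := by
    cases k with
    | zero => rfl
    | succ k => simp [picardTerm]
  have h1 : max t r ≤ max b r := max_le_max_right _ htb
  have h1' : ((max t r : T) : ℝ) ≤ (max b r : T) := h1
  rw [hmax, mul_right_comm]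
  refine (norm_picardTerm_le x₀ (lt_max_of_lt_right one_pos)
    (fun t h2 h3 => (hK t h2 h3).trans (le_max_left K 1)) k (le_max_right t r) h1).trans ?_
  gcongr

variable [CompleteSpace E] [SecondCountableTopology E]

theorem continuous_picardTerm (hT : ¬ BddAbove T.carrier) (hL : RdContinuous L) (r : T) (x₀ : E)
    (k : ℕ) : Continuous (picardTerm L r x₀ k) := by
  induction k with
  | zero => exact continuous_const
  | succ k ih =>
    have h : Continuous (lebesgueDeltaIntegral (fun s => L s (picardTerm L r x₀ k s)) r) :=
      continuous_iff_continuousAt.2 fun t =>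
        ((hL.clm_apply ih.rdContinuous).isAntiderivative hT r t).continuousAt
    exact h.comp (continuous_id.max continuous_const)

/-- Solvability of `x^Δ = L x`, `x(r) = x₀` to the right of `r`. -/
theorem exists_forward_solution (hT : ¬ BddAbove T.carrier) (hL : RdContinuous L) (r : T)
    (x₀ : E) : ∃ x : T → E, x r = x₀ ∧ ∀ t, r ≤ t → HasDeltaDerivAt x (L t (x t)) t := by
  have hgeo : ∀ C : ℝ, Summable fun k : ℕ => C * (1 / 2 : ℝ) ^ k := fun C =>
    summable_geometric_two.mul_left C
  let p := picardTerm L r x₀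
  let y : T → E := fun t => ∑' k, p k t
  have hsum : ∀ t, Summable fun k => p k t := fun t => by
    obtain ⟨C, hC⟩ := exists_picard_bound hT hL r t x₀
    exact .of_norm_bounded (hgeo C) fun k => hC k t le_rfl
  have hy : Continuous y := continuous_iff_continuousAt.2 fun t => by
    obtain ⟨b, hb⟩ := exists_gt_of_not_bddAbove hT t
    obtain ⟨C, hC⟩ := exists_picard_bound hT hL r b x₀
    exact (continuousOn_tsum (fun k => (continuous_picardTerm hT hL r x₀ k).continuousOn) (hgeo C)
      (s := Set.Iio b) fun k t ht => hC k t (Set.mem_Iio.1 ht).le).continuousAt (Iio_mem_nhds hb)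
  have hLy := hL.clm_apply hy.rdContinuous
  -- The sum `y` is frozen to the left of `r`; the integral `x` is differentiable everywhere, also
  -- at `r`, and termwise integration shows that it agrees with `y` from `r` on.
  let x : T → E := fun t => x₀ + lebesgueDeltaIntegral (fun s => L s (y s)) r t
  have hx : ∀ t, HasDeltaDerivAt x (L t (y t)) t := fun t => by
    simpa using (hasDeltaDerivAt_const x₀ t).add (hLy.isAntiderivative hT r t)
  have hxy : ∀ t, r ≤ t → x t = y t := fun t hrt => by
    have hrt' : (r : ℝ) ≤ t := hrt
    have hint : HasSum (fun k => p (k + 1) t)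
        (lebesgueDeltaIntegral (fun s => L s (y s)) r t) := by
      obtain ⟨C, hC⟩ := exists_picard_bound hT hL r t x₀
      obtain ⟨K, hK⟩ := hL.exists_norm_le hT r t
      borelize E
      simp only [p, picardTerm, max_eq_left hrt, lebesgueDeltaIntegral]
      refine intervalIntegral.hasSum_integral_of_dominated_convergence
        (fun k _ => K * (C * (1 / 2) ^ k)) (fun k => ?_) (fun k => .of_forall fun s hs => ?_)
        (.of_forall fun s _ => (hgeo C).mul_left K) intervalIntegrable_const
        (.of_forall fun s _ => ?_)
      · exact (((hL.clm_apply (continuous_picardTerm hT hL r x₀ k).rdContinuous).measurable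
          hT).comp (measurable_floor T)).aestronglyMeasurable
      · rw [Set.uIoc_of_le hrt'] at hs
        have h1 := le_floor hs.1.le
        have h2 : floor T s ≤ t := (floor_le hs.1.le).trans hs.2
        refine (ContinuousLinearMap.le_opNorm _ _).trans ?_
        exact mul_le_mul (hK _ h1 h2) (hC k _ h2) (norm_nonneg _)
          ((norm_nonneg _).trans (hK _ h1 h2))
      · exact (hsum (floor T s)).hasSum.mapL (L (floor T s))
    have h1 := (hsum t).tsum_eq_zero_add
    simp only [x, y, h1, hint.tsum_eq]
    rfl
  refine ⟨x, ?_, fun t hrt => ?_⟩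
  · simp [x, lebesgueDeltaIntegral]
  · rw [hxy t hrt]
    exact hx t

end LinearEquation

/-! ### Rd-continuity of the graininess -/

theorem RdContinuous.mul {R : Type*} [NormedRing R] {f g : T → R} (hf : RdContinuous f) (hg : RdContinuous g) :
    RdContinuous fun t => f t * g t :=
  hf.comp_continuous₂ hg continuous_mul

theorem tendsto_mu_left (t : T) : Tendsto (mu : T → ℝ) (𝓝[<] t) (𝓝 0) := by
  have h1 : Tendsto (fun s : T => (t : ℝ) - s) (𝓝[<] t) (𝓝 0) := by
    have : ContinuousAt (fun s : T => (t : ℝ) - s) t := by fun_prop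
    simpa [ContinuousAt] using this.mono_left nhdsWithin_le_nhds
  refine squeeze_zero' (.of_forall mu_nonneg) ?_ h1
  filter_upwards [self_mem_nhdsWithin] with s hs
  have h2 : (sigma s : ℝ) ≤ t := sigma_le_of_lt (Set.mem_Iio.1 hs)
  unfold mu
  linarith

theorem RightDense.mu_eq_zero {t : T} (h : RightDense t) : mu t = 0 := by
  rw [mu, h.2, sub_self]

theorem rdContinuous_mu : RdContinuous (mu : T → ℝ) := by
  refine ⟨fun t ht => ?_, fun t _ => ⟨0, tendsto_mu_left t⟩⟩
  rw [Metric.continuousAt_iff]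
  intro ε hε
  -- A point `q` just right of `t` caps `σ(s)` for all `s < q`.
  obtain ⟨q, hq, hq2⟩ := ht.exists_between (show (t : ℝ) < t + ε by linarith)
  have hq' : (0 : ℝ) < q - t := sub_pos.2 hq
  refine ⟨min ε (q - t), lt_min hε hq', fun {s} hs => ?_⟩
  rw [Subtype.dist_eq, Real.dist_eq, abs_lt] at hs
  rw [ht.mu_eq_zero, dist_zero_right, Real.norm_eq_abs, abs_of_nonneg (mu_nonneg s), mu]
  have h1 := min_le_left ε (q - t : ℝ)
  have h2 := min_le_right ε (q - t : ℝ)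
  rcases lt_or_ge s t with h | h
  · have h3 : (sigma s : ℝ) ≤ t := sigma_le_of_lt h
    linarith
  · have h3 : (sigma s : ℝ) ≤ q := sigma_le_of_lt (show (s : ℝ) < q by linarith)
    have h4 : (t : ℝ) ≤ s := h
    linarith

/-! ### Fundamental solutions and their inverses -/

section TransitionPair

variable {R : Type*} [NormedRing R] [NormedAlgebra ℝ R] {A : T → R}

/-- Regressivity alone does not bound the inverse near a left-dense point, but there `μ → 0` from
the left and `A` has a limit, so `1 + μ A → 1`. -/
theorem RdContinuous.inverse_one_add_mu_smul [CompleteSpace R] (hA : RdContinuous A)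
    (hreg : ∀ t, IsUnit (1 + mu t • A t)) :
    RdContinuous fun t => Ring.inverse (1 + mu t • A t) := by
  refine ⟨fun t ht => ?_, fun t ht => ?_⟩
  · have h1 : ContinuousAt (fun s => 1 + mu s • A s) t :=
      continuousAt_const.add ((rdContinuous_mu.1 t ht).smul (hA.1 t ht))
    obtain ⟨u, hu⟩ := hreg t
    exact ContinuousAt.comp (g := Ring.inverse) (hu ▸ NormedRing.inverse_continuousAt u) h1
  · obtain ⟨l, hl⟩ := hA.2 t ht
    have h1 : Tendsto (fun s => 1 + mu s • A s) (𝓝[<] t) (𝓝 ((1 : Rˣ) : R)) := by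
      simpa using ((tendsto_mu_left t).smul hl).const_add (1 : R)
    exact ⟨_, (NormedRing.inverse_continuousAt 1).tendsto.comp h1⟩

/-- `A (I + μ A)⁻¹`: the inverse of a fundamental solution `X` of `X^Δ = A X` satisfies
`Y^Δ = -Y A (I + μ A)⁻¹`. -/
noncomputable def adjointCoeff (A : T → R) (t : T) : R := A t * Ring.inverse (1 + mu t • A t)

theorem hasDeltaDerivAt_adjoint_mul_solution {t : T} (hreg : IsUnit (1 + mu t • A t)) {X Y : T → R}
    (hX : HasDeltaDerivAt X (A t * X t) t) (hY : HasDeltaDerivAt Y (-(Y t * adjointCoeff A t)) t) :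
    HasDeltaDerivAt (fun s => Y s * X s) 0 t := by
  have h := hY.bilinear (ContinuousLinearMap.mul ℝ R) hX
  simp only [ContinuousLinearMap.mul_apply'] at h
  have h0 : -(Y t * adjointCoeff A t) * X (sigma t) + Y t * (A t * X t) = 0 := by
    have h1 : X (sigma t) = (1 + mu t • A t) * X t := by
      rw [hX.sigma_eq, add_mul, one_mul, smul_mul_assoc]
    rw [h1, adjointCoeff, neg_mul, mul_assoc, mul_assoc (A t), ← mul_assoc (Ring.inverse _),
      Ring.inverse_mul_cancel _ hreg, one_mul, neg_add_cancel]
  rwa [h0] at h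

theorem adjoint_sigma_eq {t : T} (hreg : IsUnit (1 + mu t • A t)) {Y : T → R}
    (hY : HasDeltaDerivAt Y (-(Y t * adjointCoeff A t)) t) :
    Y (sigma t) = Y t * Ring.inverse (1 + mu t • A t) := by
  have h1 : (1 + mu t • A t) * Ring.inverse (1 + mu t • A t) = 1 :=
    Ring.mul_inverse_cancel _ hreg
  rw [add_mul, one_mul, smul_mul_assoc] at h1
  calc Y (sigma t) = Y t * (Ring.inverse (1 + mu t • A t) +
        mu t • (A t * Ring.inverse (1 + mu t • A t))) + mu t • -(Y t * adjointCoeff A t) := by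
        rw [h1, mul_one, hY.sigma_eq]
    _ = Y t * Ring.inverse (1 + mu t • A t) := by
        rw [mul_add, mul_smul_comm, smul_neg, adjointCoeff, add_neg_cancel_right]

/-- Turns the adjoint equation into `Y^Δ = -Y^σ A`, since `A` commutes with `(1 + μ A)⁻¹`. -/
theorem mul_adjointCoeff_eq {t : T} (hreg : IsUnit (1 + mu t • A t)) {Y : T → R}
    (hY : HasDeltaDerivAt Y (-(Y t * adjointCoeff A t)) t) :
    Y t * adjointCoeff A t = Y (sigma t) * A t := by
  have hc : Commute (A t) (1 + mu t • A t) :=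
    (Commute.one_right _).add_right ((Commute.refl _).smul_right _)
  rw [adjoint_sigma_eq hreg hY, adjointCoeff, mul_assoc]
  obtain ⟨u, hu⟩ := hreg
  rw [← hu] at hc ⊢
  rw [Ring.inverse_unit, hc.units_inv_right.eq]

/-- `X` and `Y` solve `X^Δ = A X` and `Y^Δ = -Y A (I + μ A)⁻¹` on `T`, with `X(s) = Y(s) = I`. -/
structure IsTransitionPair (A : T → R) (s : T) (X Y : T → R) : Prop where
  left_eq : X s = 1
  right_eq : Y s = 1
  left_deriv : ∀ t, HasDeltaDerivAt X (A t * X t) t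
  right_deriv : ∀ t, HasDeltaDerivAt Y (-(Y t * adjointCoeff A t)) t

theorem adjoint_mul_solution_eq (hT : ¬ BddAbove T.carrier) (hreg : ∀ t, IsUnit (1 + mu t • A t))
    {X Y : T → R} {a : T} (hX : ∀ t, a ≤ t → HasDeltaDerivAt X (A t * X t) t)
    (hY : ∀ t, a ≤ t → HasDeltaDerivAt Y (-(Y t * adjointCoeff A t)) t) {b : T} (hab : a ≤ b) :
    Y b * X b = Y a * X a :=
  eq_of_hasDeltaDerivAt_zero hT (F := fun s => Y s * X s) hab fun t h1 _ =>
    hasDeltaDerivAt_adjoint_mul_solution (hreg t) (hX t h1) (hY t h1)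

theorem IsTransitionPair.adjoint_mul (hT : ¬ BddAbove T.carrier)
    (hreg : ∀ t, IsUnit (1 + mu t • A t)) {s : T} {X Y Z : T → R} (h : IsTransitionPair A s X Y)
    (hZ : ∀ t, HasDeltaDerivAt Z (A t * Z t) t) (t : T) : Y t * Z t = Z s := by
  have h1 : Y t * Z t = Y s * Z s := by
    rcases le_total s t with hst | hst
    · exact adjoint_mul_solution_eq hT hreg (fun t _ => hZ t) (fun t _ => h.right_deriv t) hst
    · exact (adjoint_mul_solution_eq hT hreg (fun t _ => hZ t)
        (fun t _ => h.right_deriv t) hst).symm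
  rw [h1, h.right_eq, one_mul]

variable [CompleteSpace R] [SecondCountableTopology R]

theorem exists_forward_pair (hT : ¬ BddAbove T.carrier) (hA : RdContinuous A)
    (hreg : ∀ t, IsUnit (1 + mu t • A t)) (r : T) :
    ∃ W V : T → R, W r = 1 ∧ V r = 1 ∧ (∀ t, r ≤ t → HasDeltaDerivAt W (A t * W t) t) ∧
      ∀ t, r ≤ t → HasDeltaDerivAt V (-(V t * adjointCoeff A t)) t := by
  obtain ⟨W, h1, h2⟩ := exists_forward_solution hT
    (hA.comp_continuous (ContinuousLinearMap.mul ℝ R).continuous) r (1 : R)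
  obtain ⟨V, h3, h4⟩ := exists_forward_solution hT
    ((hA.mul (hA.inverse_one_add_mu_smul hreg)).comp_continuous
      (-(ContinuousLinearMap.mul ℝ R).flip).continuous) r (1 : R)
  exact ⟨W, V, h1, h3, fun t ht => by simpa using h2 t ht,
    fun t ht => by simpa [adjointCoeff] using h4 t ht⟩

variable [IsDedekindFiniteMonoid R]

/-- To pass from `s` to `t`, go back from `s` to some `r` below both with the inverse `V r s`, then
forward with `W r t`. Dedekind finiteness makes the left inverse `V` two-sided. -/
theorem exists_isTransitionPair (hT : ¬ BddAbove T.carrier) (hA : RdContinuous A)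
    (hreg : ∀ t, IsUnit (1 + mu t • A t)) (s : T) : ∃ X Y, IsTransitionPair A s X Y := by
  choose W V hW1 hV1 hW hV using exists_forward_pair hT hA hreg
  have hVW : ∀ r t, r ≤ t → V r t * W r t = 1 := fun r t hrt => by
    rw [adjoint_mul_solution_eq hT hreg (hW r) (hV r) hrt, hW1, hV1, one_mul]
  have hWV : ∀ r t, r ≤ t → W r t * V r t = 1 := fun r t hrt => mul_eq_one_symm (hVW r t hrt)
  have hWW : ∀ r p t, r ≤ p → p ≤ t → W r t = W p t * W r p := fun r p t hrp hpt => by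
    have h := adjoint_mul_solution_eq hT hreg (fun t ht => hW r t (hrp.trans ht)) (hV p) hpt
    rw [hV1, one_mul] at h
    rw [← h, ← mul_assoc, hWV p t hpt, one_mul]
  have hVV : ∀ r p t, r ≤ p → p ≤ t → V r t = V r p * V p t := fun r p t hrp hpt => by
    refine left_inv_eq_right_inv (hVW r t (hrp.trans hpt)) ?_
    rw [hWW r p t hrp hpt, mul_assoc, ← mul_assoc (W r p), hWV r p hrp, one_mul, hWV p t hpt]
  -- The product is independent of the base point: `min t q` serves as definition, while near a
  -- given `t` a fixed `r` can be used, so that only one factor varies.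
  have hglue : ∀ r t q, r ≤ t → r ≤ q → W (min t q) t * V (min t q) q = W r t * V r q :=
    fun r t q ht hq => by
      rw [hWW r _ t (le_min ht hq) (min_le_left _ _), hVV r _ q (le_min ht hq) (min_le_right _ _),
        mul_assoc, ← mul_assoc (W r _), hWV r _ (le_min ht hq), one_mul]
  refine ⟨fun t => W (min t s) t * V (min t s) s, fun t => W (min s t) s * V (min s t) t,
    by simp [hW1, hV1], by simp [hW1, hV1], fun t => ?_, fun t => ?_⟩
  · obtain ⟨r, hrt, hrs, hr⟩ := exists_le_Ici_mem_nhds t s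
    have h := (hW r t hrt).clm_apply ((ContinuousLinearMap.mul ℝ R).flip (V r s))
    simp only [ContinuousLinearMap.flip_apply, ContinuousLinearMap.mul_apply'] at h
    rw [hglue r t s hrt hrs, ← mul_assoc]
    refine h.congr_of_eventuallyEq ?_ (hglue r _ s (hrt.trans (le_sigma t)) hrs)
    filter_upwards [hr] with q hq using hglue r q s hq hrs
  · obtain ⟨r, hrt, hrs, hr⟩ := exists_le_Ici_mem_nhds t s
    have h := (hV r t hrt).clm_apply (ContinuousLinearMap.mul ℝ R (W r s))
    simp only [ContinuousLinearMap.mul_apply', mul_neg, ← mul_assoc] at h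
    rw [hglue r s t hrs hrt]
    refine h.congr_of_eventuallyEq ?_ (hglue r s _ hrs (hrt.trans (le_sigma t)))
    filter_upwards [hr] with q hq using hglue r s q hrs hq

end TransitionPair

/-! ### The transition matrix -/

section MatrixTransition

attribute [local instance] Matrix.linftyOpNormedRing Matrix.linftyOpNormedAlgebra

variable {n : ℕ}

theorem hasDeltaDerivAt_matrix_iff {X : T → Matrix (Fin n) (Fin n) ℝ}
    {X' : Matrix (Fin n) (Fin n) ℝ} {t : T} :
    HasDeltaDerivAt X X' t ↔ ∀ i j, HasDeltaDerivAt (fun s => X s i j) (X' i j) t := by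
  refine ⟨fun h i j => h.clm_apply (LinearMap.toContinuousLinearMap (Matrix.entryLinearMap ℝ ℝ i j)),
    fun h => ?_⟩
  rw [show X = fun s => ∑ i, ∑ j, X s i j • Matrix.single i j (1 : ℝ) from
    funext fun s => by simpa using Matrix.matrix_eq_sum_single (X s),
    show X' = ∑ i, ∑ j, X' i j • Matrix.single i j (1 : ℝ) by
      simpa using Matrix.matrix_eq_sum_single X']
  exact HasDeltaDerivAt.sum fun i _ => HasDeltaDerivAt.sum fun j _ =>
    (h i j).clm_apply (ContinuousLinearMap.toSpanSingleton ℝ (Matrix.single i j (1 : ℝ)))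

theorem rdContinuous_matrix_iff {M : T → Matrix (Fin n) (Fin n) ℝ} :
    RdContinuous M ↔ MatrixRdContinuous M := by
  refine ⟨fun h i j => h.comp_continuous
    (LinearMap.toContinuousLinearMap (Matrix.entryLinearMap ℝ ℝ i j)).continuous, fun h => ?_⟩
  refine ⟨fun t ht => ?_, fun t ht => ?_⟩
  · exact continuousAt_pi.2 fun i => continuousAt_pi.2 fun j => (h i j).1 t ht
  · choose l hl using fun i j => (h i j).2 t ht
    exact ⟨l, tendsto_pi_nhds.2 fun i => tendsto_pi_nhds.2 fun j => hl i j⟩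

theorem isTransitionSolution_iff {A : T → Matrix (Fin n) (Fin n) ℝ} {s : T}
    {X : T → Matrix (Fin n) (Fin n) ℝ} :
    IsTransitionSolution A s X ↔ (∀ t, HasDeltaDerivAt X (A t * X t) t) ∧ X s = 1 := by
  simp only [IsTransitionSolution, hasDeltaDerivAt_matrix_iff]

variable {A : T → Matrix (Fin n) (Fin n) ℝ}

theorem IsTransitionPair.adjoint_mul_self (hT : ¬ BddAbove T.carrier) (hreg : Regressive A) {s : T}
    {X Y : T → Matrix (Fin n) (Fin n) ℝ} (h : IsTransitionPair A s X Y) (t : T) :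
    Y t * X t = 1 := by
  rw [h.adjoint_mul hT hreg h.left_deriv, h.left_eq]

theorem IsTransitionPair.eq_of_isTransitionSolution (hT : ¬ BddAbove T.carrier)
    (hreg : Regressive A) {s : T} {X Y Z : T → Matrix (Fin n) (Fin n) ℝ}
    (h : IsTransitionPair A s X Y) (hZ : IsTransitionSolution A s Z) : Z = X := by
  rw [isTransitionSolution_iff] at hZ
  funext t
  have h1 := h.adjoint_mul hT hreg hZ.1 t
  rw [hZ.2] at h1
  exact (left_inv_eq_right_inv (mul_eq_one_symm (h.adjoint_mul_self hT hreg t)) h1).symm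

theorem IsTransitionPair.isTransitionSolution {s : T} {X Y : T → Matrix (Fin n) (Fin n) ℝ}
    (h : IsTransitionPair A s X Y) : IsTransitionSolution A s X :=
  isTransitionSolution_iff.2 ⟨h.left_deriv, h.left_eq⟩

theorem existsUnique_isTransitionSolution (hT : ¬ BddAbove T.carrier) (hA : MatrixRdContinuous A)
    (hreg : Regressive A) (s : T) : ∃! X, IsTransitionSolution A s X := by
  obtain ⟨X, Y, h⟩ := exists_isTransitionPair hT (rdContinuous_matrix_iff.2 hA) hreg s
  exact ⟨X, h.isTransitionSolution, fun Z hZ => h.eq_of_isTransitionSolution hT hreg hZ⟩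

theorem transitionMatrix_eq (hT : ¬ BddAbove T.carrier) (hA : MatrixRdContinuous A)
    (hreg : Regressive A) {s : T} {X : T → Matrix (Fin n) (Fin n) ℝ}
    (hX : IsTransitionSolution A s X) (t : T) : transitionMatrix A t s = X t := by
  have h : ∃ X, IsTransitionSolution A s X := ⟨X, hX⟩
  rw [transitionMatrix, dif_pos h,
    (existsUnique_isTransitionSolution hT hA hreg s).unique h.choose_spec hX]

/-- The solution started at `s` is `t ↦ X(t) Y(s)`; evaluate it at `t₀`. -/
theorem IsTransitionPair.transitionMatrix_eq_right (hT : ¬ BddAbove T.carrier)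
    (hA : MatrixRdContinuous A) (hreg : Regressive A) {t₀ : T}
    {X Y : T → Matrix (Fin n) (Fin n) ℝ} (h : IsTransitionPair A t₀ X Y) (s : T) :
    transitionMatrix A t₀ s = Y s := by
  have h1 : IsTransitionSolution A s fun t => X t * Y s := by
    refine isTransitionSolution_iff.2
      ⟨fun t => ?_, mul_eq_one_symm (h.adjoint_mul_self hT hreg s)⟩
    have h2 := (h.left_deriv t).clm_apply ((ContinuousLinearMap.mul ℝ _).flip (Y s))
    simpa only [ContinuousLinearMap.flip_apply, ContinuousLinearMap.mul_apply', mul_assoc] using h2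
  rw [transitionMatrix_eq hT hA hreg h1, h.left_eq, one_mul]

/-- A fundamental solution `X` with `X(t₀) = I`, whose inverse is `Φ_A(t₀, ·)`. -/
theorem exists_fundamental_solution (hT : ¬ BddAbove T.carrier) (hA : MatrixRdContinuous A)
    (hreg : Regressive A) (t₀ : T) :
    ∃ X : T → Matrix (Fin n) (Fin n) ℝ, IsTransitionSolution A t₀ X ∧
      (∀ t, transitionMatrix A t₀ t * X t = 1) ∧
      (∀ t i j, HasDeltaDerivAt (fun s => transitionMatrix A t₀ s i j)
        ((-(transitionMatrix A t₀ (sigma t) * A t)) i j) t) ∧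
      MatrixRdContinuous fun t => transitionMatrix A t₀ (sigma t) := by
  have hA' := rdContinuous_matrix_iff.2 hA
  obtain ⟨X, Y, h⟩ := exists_isTransitionPair hT hA' hreg t₀
  simp only [h.transitionMatrix_eq_right hT hA hreg]
  refine ⟨X, h.isTransitionSolution, h.adjoint_mul_self hT hreg, fun t => ?_, ?_⟩
  · rw [← hasDeltaDerivAt_matrix_iff, ← mul_adjointCoeff_eq (hreg t) (h.right_deriv t)]
    exact h.right_deriv t
  · have hY : Continuous Y := continuous_iff_continuousAt.2 fun t => (h.right_deriv t).continuousAt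
    rw [← rdContinuous_matrix_iff]
    -- `Y(σ(t)) = Y(t) (1 + μ A)⁻¹` removes the composition with `σ`.
    simp only [adjoint_sigma_eq (hreg _) (h.right_deriv _)]
    exact hY.rdContinuous.mul (hA'.inverse_one_add_mu_smul hreg)

end MatrixTransition

/-! ### Surjectivity of the input map -/

section IntegralFunctional

theorem RdContinuous.sum {E : Type*} [NormedAddCommGroup E] {ι : Type*} {S : Finset ι}
    {f : ι → T → E} (hf : ∀ i ∈ S, RdContinuous (f i)) : RdContinuous fun t => ∑ i ∈ S, f i t := by
  classical
  induction S using Finset.induction_on with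
  | empty => simpa using (continuous_const (y := (0 : E))).rdContinuous
  | insert i S hi ih =>
    simp only [Finset.sum_insert hi]
    exact (hf i (Finset.mem_insert_self _ _)).comp_continuous₂
      (ih fun j hj => hf j (Finset.mem_insert_of_mem hj)) continuous_add

theorem RdContinuous.const_mul {f : T → ℝ} (hf : RdContinuous f) (c : ℝ) :
    RdContinuous fun t => c * f t :=
  hf.comp_continuous (continuous_const_mul c)

theorem RdContinuous.dotProduct {k : ℕ} {x y : T → Fin k → ℝ}
    (hx : ∀ i, RdContinuous fun t => x t i) (hy : ∀ i, RdContinuous fun t => y t i) :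
    RdContinuous fun t => x t ⬝ᵥ y t :=
  RdContinuous.sum fun i _ => (hx i).mul (hy i)

theorem MatrixRdContinuous.mul {k l p : ℕ} {M : T → Matrix (Fin k) (Fin l) ℝ}
    {N : T → Matrix (Fin l) (Fin p) ℝ} (hM : MatrixRdContinuous M) (hN : MatrixRdContinuous N) :
    MatrixRdContinuous fun t => M t * N t :=
  fun i j => RdContinuous.dotProduct (fun q => hM i q) fun q => hN q j

theorem MatrixRdContinuous.mulVec {k l : ℕ} {M : T → Matrix (Fin k) (Fin l) ℝ}
    {x : T → Fin l → ℝ} (hM : MatrixRdContinuous M) (hx : ∀ j, RdContinuous fun t => x t j)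
    (i : Fin k) : RdContinuous fun t => (M t).mulVec (x t) i :=
  RdContinuous.dotProduct (fun q => hM i q) hx

theorem MatrixRdContinuous.transpose {k l : ℕ} {M : T → Matrix (Fin k) (Fin l) ℝ}
    (hM : MatrixRdContinuous M) : MatrixRdContinuous fun t => (M t).transpose :=
  fun i j => hM j i

theorem RdContinuous.deltaIntegral_eq (hT : ¬ BddAbove T.carrier) {f : T → ℝ}
    (hf : RdContinuous f) {a b : T} (hab : a ≤ b) :
    deltaIntegral f a b = lebesgueDeltaIntegral f a b := by
  rw [(hf.isAntiderivative hT a).deltaIntegral_eq hT hab]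
  simp [lebesgueDeltaIntegral]

theorem lebesgueDeltaIntegral_add_fun (hT : ¬ BddAbove T.carrier) {f g : T → ℝ}
    (hf : RdContinuous f) (hg : RdContinuous g) (a b : T) :
    lebesgueDeltaIntegral (fun t => f t + g t) a b =
      lebesgueDeltaIntegral f a b + lebesgueDeltaIntegral g a b :=
  intervalIntegral.integral_add (hf.intervalIntegrable_floor hT a b)
    (hg.intervalIntegrable_floor hT a b)

theorem lebesgueDeltaIntegral_const_mul (c : ℝ) (f : T → ℝ) (a b : T) :
    lebesgueDeltaIntegral (fun t => c * f t) a b = c * lebesgueDeltaIntegral f a b :=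
  intervalIntegral.integral_const_mul _ _

theorem lebesgueDeltaIntegral_const_dotProduct (hT : ¬ BddAbove T.carrier) {k : ℕ} (v : Fin k → ℝ)
    {x : T → Fin k → ℝ} (hx : ∀ i, RdContinuous fun t => x t i) (a b : T) :
    lebesgueDeltaIntegral (fun t => v ⬝ᵥ x t) a b =
      v ⬝ᵥ fun i => lebesgueDeltaIntegral (fun t => x t i) a b := by
  simp only [dotProduct, ← lebesgueDeltaIntegral_const_mul]
  exact intervalIntegral.integral_finsetSum fun i _ =>
    ((hx i).const_mul (v i)).intervalIntegrable_floor hT a b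

theorem lebesgueDeltaIntegral_nonneg {f : T → ℝ} (hf : ∀ t, 0 ≤ f t) {a b : T} (hab : a ≤ b) :
    0 ≤ lebesgueDeltaIntegral f a b :=
  intervalIntegral.integral_nonneg_of_forall hab fun _ => hf _

/-- The map `u ↦ ∫ K u` on rd-continuous inputs is onto if and only if `∫ K Kᵀ` is invertible. -/
theorem forall_exists_integral_mulVec_eq_iff (hT : ¬ BddAbove T.carrier) {n m : ℕ}
    {K : T → Matrix (Fin n) (Fin m) ℝ} (hK : MatrixRdContinuous K) {a b : T} (hab : a ≤ b) :
    (∀ w : Fin n → ℝ, ∃ u : T → Fin m → ℝ, (∀ j, RdContinuous fun t => u t j) ∧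
      (fun i => lebesgueDeltaIntegral (fun t => (K t).mulVec (u t) i) a b) = w) ↔
      IsUnit (Matrix.of fun i j =>
        lebesgueDeltaIntegral (fun t => (K t * (K t).transpose) i j) a b) := by
  set W : Matrix (Fin n) (Fin n) ℝ := Matrix.of fun i j =>
    lebesgueDeltaIntegral (fun t => (K t * (K t).transpose) i j) a b with hW
  have hKK := hK.mul hK.transpose
  have hWv : ∀ v : Fin n → ℝ, (fun i => lebesgueDeltaIntegral
      (fun t => (K t).mulVec ((K t).transpose.mulVec v) i) a b) = W.mulVec v := fun v => by
    funext i
    have h := lebesgueDeltaIntegral_const_dotProduct hT v (x := fun t => (K t * (K t).transpose) i)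
      (fun j => hKK i j) a b
    simp only [Matrix.mulVec_mulVec]
    simp only [dotProduct_comm v] at h
    exact h
  have hKv : ∀ v : Fin n → ℝ, ∀ j, RdContinuous fun t => (K t).transpose.mulVec v j := fun v =>
    hK.transpose.mulVec fun i => continuous_const.rdContinuous
  constructor
  · intro h
    rw [Matrix.isUnit_iff_isUnit_det, isUnit_iff_ne_zero]
    intro hdet
    obtain ⟨v, hv0, hv⟩ := Matrix.exists_mulVec_eq_zero_iff.2 hdet
    obtain ⟨u, hu, huv⟩ := h v
    have hvv : 0 < v ⬝ᵥ v := by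
      refine lt_of_le_of_ne ?_ fun h0 => hv0 (dotProduct_self_eq_zero.1 h0.symm)
      exact Finset.sum_nonneg fun i _ => mul_self_nonneg _
    let q : T → Fin m → ℝ := fun t => (K t).transpose.mulVec v
    have hqu : ∀ x : T → Fin m → ℝ, (∀ j, RdContinuous fun t => x t j) →
        lebesgueDeltaIntegral (fun t => q t ⬝ᵥ x t) a b =
          v ⬝ᵥ fun i => lebesgueDeltaIntegral (fun t => (K t).mulVec (x t) i) a b := fun x hx => by
      rw [← lebesgueDeltaIntegral_const_dotProduct hT v (hK.mulVec hx)]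
      congr 1
      funext t
      rw [Matrix.dotProduct_mulVec, ← Matrix.mulVec_transpose]
    have hq := hKv v
    have h1 := hqu q hq
    have h2 := hqu u hu
    rw [hWv, hv, dotProduct_zero] at h1
    rw [huv] at h2
    set c := lebesgueDeltaIntegral (fun t => u t ⬝ᵥ u t) a b with hc
    -- This is `∫ |r q - u|² ≥ 0` with `∫ q·q = v·Wv = 0` and `∫ q·u = v·v`; that `q` vanishes is
    -- not needed.
    have key : ∀ r : ℝ, 0 ≤ (-2 * r) * (v ⬝ᵥ v) + c := fun r => by
      have hqq := (RdContinuous.dotProduct hq hq).const_mul (r * r)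
      have hqu' := (RdContinuous.dotProduct hq hu).const_mul (-2 * r)
      have huu := RdContinuous.dotProduct hu hu
      have h3 : 0 ≤ lebesgueDeltaIntegral
          (fun t => (r * r) * (q t ⬝ᵥ q t) + ((-2 * r) * (q t ⬝ᵥ u t) + u t ⬝ᵥ u t)) a b := by
        refine lebesgueDeltaIntegral_nonneg (fun t => ?_) hab
        have h4 : 0 ≤ (r • q t - u t) ⬝ᵥ (r • q t - u t) :=
          Finset.sum_nonneg fun i _ => mul_self_nonneg _
        simp only [sub_dotProduct, dotProduct_sub, smul_dotProduct, dotProduct_smul,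
          smul_eq_mul, dotProduct_comm (u t) (q t)] at h4
        linarith
      rw [lebesgueDeltaIntegral_add_fun hT hqq
        (hqu'.comp_continuous₂ huu continuous_add), lebesgueDeltaIntegral_add_fun hT hqu' huu,
        lebesgueDeltaIntegral_const_mul, lebesgueDeltaIntegral_const_mul, h1, h2] at h3
      linarith
    -- This `r` makes the right side `-1`.
    have h5 := key ((c + 1) / (2 * (v ⬝ᵥ v)))
    field_simp at h5
    linarith
  · intro h w
    refine ⟨fun t => (K t).transpose.mulVec (W⁻¹.mulVec w), hKv _, ?_⟩
    rw [hWv, Matrix.mulVec_mulVec, Matrix.mul_nonsing_inv _ ((Matrix.isUnit_iff_isUnit_det _).1 h),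
      Matrix.one_mulVec]

end IntegralFunctional

/-! ### Variation of constants and the Gramian condition -/

section Controllability

variable {n m : ℕ} {A : T → Matrix (Fin n) (Fin n) ℝ} {B : T → Matrix (Fin n) (Fin m) ℝ}

theorem gramianIntegrand_eq (t₀ t : T) :
    gramianIntegrand A B t₀ t = (transitionMatrix A t₀ (sigma t) * B t) *
      (transitionMatrix A t₀ (sigma t) * B t).transpose := by
  rw [gramianIntegrand, Matrix.transpose_mul, ← Matrix.mul_assoc]

theorem matrixRdContinuous_transitionMatrix_mul (hT : ¬ BddAbove T.carrier)
    (hA : MatrixRdContinuous A) (hB : MatrixRdContinuous B) (hreg : Regressive A) (t₀ : T) :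
    MatrixRdContinuous fun t => transitionMatrix A t₀ (sigma t) * B t := by
  obtain ⟨X, -, -, -, h⟩ := exists_fundamental_solution hT hA hreg t₀
  exact h.mul hB

theorem rdContinuous_gramianIntegrand (hT : ¬ BddAbove T.carrier)
    (hA : MatrixRdContinuous A) (hB : MatrixRdContinuous B) (hreg : Regressive A) (t₀ : T) :
    MatrixRdContinuous fun t => gramianIntegrand A B t₀ t := by
  have h := matrixRdContinuous_transitionMatrix_mul hT hA hB hreg t₀
  simp only [gramianIntegrand_eq]
  exact h.mul h.transpose

/-- Variation of constants: `Φ_A(t₀, t) x(t) = x₀ + ∫_{t₀}^t Φ_A(t₀, σ(s)) B(s) u(s) Δs`. -/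
theorem exists_isSystemSolution_eq_iff (hT : ¬ BddAbove T.carrier) (hA : MatrixRdContinuous A)
    (hB : MatrixRdContinuous B) (hreg : Regressive A) {t₀ tf : T} (htf : t₀ ≤ tf)
    {u : T → Fin m → ℝ} (hu : ∀ j, RdContinuous fun t => u t j) (x₀ xf : Fin n → ℝ) :
    (∃ x, IsSystemSolution A B u t₀ x₀ x ∧ x tf = xf) ↔
      (fun i => lebesgueDeltaIntegral
        (fun t => (transitionMatrix A t₀ (sigma t) * B t).mulVec (u t) i) t₀ tf) =
        (transitionMatrix A t₀ tf).mulVec xf - x₀ := by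
  obtain ⟨X, hX, hinv, hderiv, -⟩ := exists_fundamental_solution hT hA hreg t₀
  have hX1 := transitionMatrix_eq hT hA hreg hX t₀
  rw [hX.2] at hX1
  have hinv' : ∀ t, X t * transitionMatrix A t₀ t = 1 := fun t => mul_eq_one_symm (hinv t)
  have hK := (matrixRdContinuous_transitionMatrix_mul hT hA hB hreg t₀).mulVec hu
  constructor
  · rintro ⟨x, ⟨hx, hx0⟩, rfl⟩
    funext i
    have hz : IsAntiderivative (fun t => (transitionMatrix A t₀ t).mulVec (x t) i)
        (fun t => (transitionMatrix A t₀ (sigma t) * B t).mulVec (u t) i) := fun t => by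
      -- The terms `-Φ(t₀, σ(t)) A x` and `Φ(t₀, σ(t)) A x` cancel.
      have h := HasDeltaDerivAt.mulVec (hderiv t) (hx t) i
      rwa [Matrix.mulVec_add, Matrix.mulVec_mulVec, Matrix.mulVec_mulVec, Matrix.neg_mulVec,
        neg_add_cancel_left] at h
    rw [← (hK i).deltaIntegral_eq hT htf, hz.deltaIntegral_eq hT htf, hx0, hX1,
      Matrix.one_mulVec, Pi.sub_apply]
  · intro h
    let z : T → Fin n → ℝ := fun t i => x₀ i + lebesgueDeltaIntegral
      (fun t => (transitionMatrix A t₀ (sigma t) * B t).mulVec (u t) i) t₀ t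
    have hz : ∀ t i, HasDeltaDerivAt (fun s => z s i)
        ((transitionMatrix A t₀ (sigma t) * B t).mulVec (u t) i) t := fun t i => by
      simpa using (hasDeltaDerivAt_const (x₀ i) t).add ((hK i).isAntiderivative hT t₀ t)
    refine ⟨fun t => (X t).mulVec (z t), ⟨fun t i => ?_, ?_⟩, ?_⟩
    · have h1 := HasDeltaDerivAt.mulVec (hX.1 t) (hz t) i
      rwa [Matrix.mulVec_mulVec, ← Matrix.mul_assoc, hinv', Matrix.one_mul,
        ← Matrix.mulVec_mulVec] at h1
    · have h1 : z t₀ = x₀ := by funext i; simp [z, lebesgueDeltaIntegral]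
      simp [h1, hX.2]
    · have h1 : z tf = (transitionMatrix A t₀ tf).mulVec xf := by
        funext i
        have h2 := congrFun h i
        simp only [z, h2, Pi.sub_apply]
        ring
      simp [h1, Matrix.mulVec_mulVec, hinv']

/-- For each `xf` the map `x₀ ↦ Φ(t₀, tf) xf - x₀` is a bijection of ℝⁿ, so the condition does not
depend on `xf`. -/
theorem controllableTo_iff (hT : ¬ BddAbove T.carrier) (hA : MatrixRdContinuous A)
    (hB : MatrixRdContinuous B) (hreg : Regressive A) {t₀ tf : T} (htf : t₀ ≤ tf)
    (xf : Fin n → ℝ) :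
    ControllableTo A B t₀ tf xf ↔ IsUnit (controllabilityGramian A B t₀ tf) := by
  have hW : controllabilityGramian A B t₀ tf = Matrix.of fun i j => lebesgueDeltaIntegral
      (fun t => ((transitionMatrix A t₀ (sigma t) * B t) *
        (transitionMatrix A t₀ (sigma t) * B t).transpose) i j) t₀ tf := by
    ext i j
    simp only [controllabilityGramian, Matrix.of_apply, ← gramianIntegrand_eq]
    exact (rdContinuous_gramianIntegrand hT hA hB hreg t₀ i j).deltaIntegral_eq hT htf
  rw [hW, ← forall_exists_integral_mulVec_eq_iff hT
    (matrixRdContinuous_transitionMatrix_mul hT hA hB hreg t₀) htf]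
  constructor
  · intro h w
    obtain ⟨u, hu, hx⟩ := h ((transitionMatrix A t₀ tf).mulVec xf - w)
    rw [exists_isSystemSolution_eq_iff hT hA hB hreg htf hu, sub_sub_cancel] at hx
    exact ⟨u, hu, hx⟩
  · intro h x₀
    obtain ⟨u, hu, hx⟩ := h ((transitionMatrix A t₀ tf).mulVec xf - x₀)
    exact ⟨u, hu, (exists_isSystemSolution_eq_iff hT hA hB hreg htf hu x₀ xf).2 hx⟩

end Controllability

end TimeScale

theorem theorem2p2 (T : TimeScale) (hT : ¬ BddAbove T.carrier) {n m : ℕ}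
    (A : T → Matrix (Fin n) (Fin n) ℝ) (B : T → Matrix (Fin n) (Fin m) ℝ)
    (hA : TimeScale.MatrixRdContinuous A) (hB : TimeScale.MatrixRdContinuous B)
    (hreg : TimeScale.Regressive A) (t₀ tf : T) (htf : t₀ ≤ tf) :
    -- the transition matrix is well defined
    (∀ s : T, ∃! X : T → Matrix (Fin n) (Fin n) ℝ, TimeScale.IsTransitionSolution A s X) ∧
    -- the entries of the integrand of the Gramian have delta antiderivatives
    (∀ i j, ∃ F : T → ℝ,
      TimeScale.IsAntiderivative F (fun t => TimeScale.gramianIntegrand A B t₀ t i j)) ∧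
    -- the Gramian condition, for arbitrary and for prescribed final states
    (TimeScale.Controllable A B t₀ tf ↔ IsUnit (TimeScale.controllabilityGramian A B t₀ tf)) ∧
    (∀ xf : Fin n → ℝ, TimeScale.ControllableTo A B t₀ tf xf ↔
      IsUnit (TimeScale.controllabilityGramian A B t₀ tf)) := by
  refine ⟨TimeScale.existsUnique_isTransitionSolution hT hA hreg, fun i j => ?_, ⟨fun h => ?_,
    fun h xf => ?_⟩, TimeScale.controllableTo_iff hT hA hB hreg htf⟩
  · exact ⟨_, (TimeScale.rdContinuous_gramianIntegrand hT hA hB hreg t₀ i j).isAntiderivative hT t₀⟩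
  · exact (TimeScale.controllableTo_iff hT hA hB hreg htf 0).1 (h 0)
  · exact (TimeScale.controllableTo_iff hT hA hB hreg htf xf).2 h
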